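/- Let $I$ be a set of sites. Let $\mathcal A$ be a quasilocal C*-algebra over $I$: a unital C*-algebra with closed unital *-subalgebras $\mathcal A(\Lambda)$, indexed by the finite subsets $\Lambda\subset I$, such that $\mathcal A(\Lambda)\subset\mathcal A(\Lambda')$ if $\Lambda\subset\Lambda'$, $[\mathcal A(\Lambda),\mathcal A(\Lambda')]=0$ if $\Lambda\cap\Lambda'=\emptyset$, and $\bigcup_\Lambda\mathcal A(\Lambda)$ is norm dense in $\mathcal A$. Each $\mathcal A(\Lambda)$ is identified, by a faithful unital *-representation on a Hilbert space $\mathcal H_\Lambda$, with a *-algebra of bounded operators on $\mathcal H_\Lambda$ (for instance with all of $B(\mathcal H_\Lambda)$). Let $(\Lambda_k)_{k\in\mathbb N}$ be a sequence of finite subsets of $I$ such that every finite subset of $I$ is contained in $\Lambda_k$ for all large $k$, and write $\mathcal A_k=\mathcal A(\Lambda_k)$, $\mathcal H_k=\mathcal H_{\Lambda_k}$. Let $x_k,y_k\in\mathcal H_k$ be unit vectors, with vector states $\omega_{x_k}(A)=(x_k,Ax_k)$ and $\omega_{y_k}(A)=(y_k,Ay_k)$ on $\mathcal A_k$, and $$\|\omega_{x_k}-\omega_{y_k}\|=\sup_{A\in\mathcal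 A_k,\ \|A\|\le 1}|\omega_{x_k}(A)-\omega_{y_k}(A)| .$$ Theorem. Suppose that $\omega_{x_k}$ and $\omega_{y_k}$, extended in some way to states on $\mathcal A$, converge weak* on $\mathcal A$ to states $\omega_1^T$ and $\omega_2^T$, respectively, as $k\to\infty$. If $\omega_1^T$ and $\omega_2^T$ are disjoint, that is, if no nonzero subrepresentation of the GNS representation of $\omega_1^T$ is unitarily equivalent to a subrepresentation of the GNS representation of $\omega_2^T$, then the transition probability between $\omega_1^T$ and $\omega_2^T$, $$\lim_{k\to\infty}\Bigl(1-\tfrac14\|\omega_{x_k}-\omega_{y_k}\|^2\Bigr),$$ exists and equals $0$. -/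

import Mathlib

open Filter Topology
open scoped ComplexOrder InnerProductSpace

/-- A quasilocal C*-algebra over a set `I` of sites.  The unital C*-algebra `A` is the norm closure
of the union of a net of unital C*-subalgebras `loc Λ` (the observables of the finite region `Λ`),
which is isotone and causal.  Each local algebra is identified, through the faithful unital
*-representation `rep Λ`, with an algebra of bounded operators on the Hilbert space `H Λ` of the
finite system in `Λ`.  The case `loc Λ = B(H Λ)` is the one where every `rep Λ` is bijective. -/
structure QuasilocalAlgebra (I : Type*) (A : Type*) [CStarAlgebra A] (H : Finset I → Type*)
    [∀ Λ, NormedAddCommGroup (H Λ)] [∀ Λ, InnerProductSpace ℂ (H Λ)]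
    [∀ Λ, CompleteSpace (H Λ)] where
  /-- the observables of the region `Λ` -/
  loc : Finset I → StarSubalgebra ℂ A
  isClosed_loc : ∀ Λ, IsClosed (loc Λ : Set A)
  isotony : ∀ Λ Λ', Λ ⊆ Λ' → loc Λ ≤ loc Λ'
  causality : ∀ Λ Λ', Disjoint Λ Λ' → ∀ a ∈ loc Λ, ∀ b ∈ loc Λ', a * b = b * a
  dense_iUnion_loc : Dense (⋃ Λ, (loc Λ : Set A))
  /-- the local observables as bounded operators -/
  rep : ∀ Λ, loc Λ →⋆ₐ[ℂ] (H Λ →L[ℂ] H Λ)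
  rep_injective : ∀ Λ, Function.Injective (rep Λ)

namespace QuasilocalAlgebra

variable {I : Type*} {A : Type*} [CStarAlgebra A] {H : Finset I → Type*}
    [∀ Λ, NormedAddCommGroup (H Λ)] [∀ Λ, InnerProductSpace ℂ (H Λ)]
    [∀ Λ, CompleteSpace (H Λ)]

theorem norm_rep_le (Q : QuasilocalAlgebra I A H) (Λ : Finset I) (a : Q.loc Λ) :
    ‖Q.rep Λ a‖ ≤ ‖a‖ := by
  have : IsClosed (Q.loc Λ : Set A) := Q.isClosed_loc Λ
  exact NonUnitalStarAlgHom.norm_apply_le (Q.rep Λ) a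

/-- The functional `a ↦ (x, a x)` on the local algebra of the region `Λ` defined by a vector `x` of
the finite system.  It is an element of the Banach dual of `loc Λ`, so the norm of a difference of
two such functionals is the supremum of the absolute value over the unit ball of `loc Λ`. -/
noncomputable def vectorFunctional (Q : QuasilocalAlgebra I A H) (Λ : Finset I) (x : H Λ) :
    Q.loc Λ →L[ℂ] ℂ :=
  LinearMap.mkContinuous
    { toFun := fun a => ⟪x, Q.rep Λ a x⟫_ℂ
      map_add' := fun a b => by simp
      map_smul' := fun c a => by simp }
    (‖x‖ * ‖x‖)
    (fun a => by
      calc ‖⟪x, Q.rep Λ a x⟫_ℂ‖ ≤ ‖x‖ * ‖Q.rep Λ a x‖ := norm_inner_le_norm _ _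
        _ ≤ ‖x‖ * (‖a‖ * ‖x‖) := by
            gcongr
            exact (Q.rep Λ a).le_of_opNorm_le (Q.norm_rep_le Λ a) x
        _ = ‖x‖ * ‖x‖ * ‖a‖ := by ring)

/-- `p` is the transition probability between the limits of the vector states given by the vectors
`x k` and `y k` of the finite systems in the regions `Λ k`: the limit of
`1 - (1/4) ‖ω_{x k} - ω_{y k}‖ ^ 2` exists and equals `p`. -/
def HasTransitionProbability (Q : QuasilocalAlgebra I A H) (Λ : ℕ → Finset I)
    (x y : ∀ k, H (Λ k)) (p : ℝ) : Prop :=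
  Tendsto
    (fun k => 1 - (1 / 4 : ℝ) *
      ‖Q.vectorFunctional (Λ k) (x k) - Q.vectorFunctional (Λ k) (y k)‖ ^ 2)
    atTop (𝓝 p)

end QuasilocalAlgebra

/-- A state: a normalized positive linear functional. -/
def IsState {A : Type*} [CStarAlgebra A] [PartialOrder A] (ω : A →ₚ[ℂ] ℂ) : Prop :=
  ω 1 = 1

/-- Weak* convergence of a sequence of functionals. -/
def WeakStarTendsto {A : Type*} [CStarAlgebra A] [PartialOrder A]
    (φ : ℕ → A →ₚ[ℂ] ℂ) (ω : A →ₚ[ℂ] ℂ) : Prop :=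
  ∀ a : A, Tendsto (fun k => φ k a) atTop (𝓝 (ω a))

/-- A closed subspace invariant under the representation `π`, i.e. the space of a
subrepresentation of `π`. -/
def IsSubrepresentation {A E : Type*} [CStarAlgebra A] [NormedAddCommGroup E]
    [InnerProductSpace ℂ E] [CompleteSpace E] (π : A →⋆ₐ[ℂ] (E →L[ℂ] E))
    (K : Submodule ℂ E) : Prop :=
  IsClosed (K : Set E) ∧ ∀ a : A, ∀ v ∈ K, π a v ∈ K

/-- The restrictions of `π₁` to `K₁` and of `π₂` to `K₂` are unitarily equivalent. -/
def UnitarilyEquivalentOn {A E₁ E₂ : Type*} [CStarAlgebra A]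
    [NormedAddCommGroup E₁] [InnerProductSpace ℂ E₁] [CompleteSpace E₁]
    [NormedAddCommGroup E₂] [InnerProductSpace ℂ E₂] [CompleteSpace E₂]
    (π₁ : A →⋆ₐ[ℂ] (E₁ →L[ℂ] E₁)) (π₂ : A →⋆ₐ[ℂ] (E₂ →L[ℂ] E₂))
    (K₁ : Submodule ℂ E₁) (K₂ : Submodule ℂ E₂) : Prop :=
  ∃ U : K₁ ≃ₗᵢ[ℂ] K₂, ∀ (a : A) (v w : K₁),
    (w : E₁) = π₁ a v → (U w : E₂) = π₂ a (U v)

/-- No (nonzero) subrepresentation of `π₁` is unitarily equivalent to a subrepresentation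
of `π₂`. -/
def DisjointRepresentations {A E₁ E₂ : Type*} [CStarAlgebra A]
    [NormedAddCommGroup E₁] [InnerProductSpace ℂ E₁] [CompleteSpace E₁]
    [NormedAddCommGroup E₂] [InnerProductSpace ℂ E₂] [CompleteSpace E₂]
    (π₁ : A →⋆ₐ[ℂ] (E₁ →L[ℂ] E₁)) (π₂ : A →⋆ₐ[ℂ] (E₂ →L[ℂ] E₂)) : Prop :=
  ∀ (K₁ : Submodule ℂ E₁) (K₂ : Submodule ℂ E₂),
    IsSubrepresentation π₁ K₁ → IsSubrepresentation π₂ K₂ → K₁ ≠ ⊥ →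
      ¬ UnitarilyEquivalentOn π₁ π₂ K₁ K₂

/-- Two states are disjoint if their GNS representations are. -/
def DisjointStates {A : Type*} [CStarAlgebra A] [PartialOrder A] [StarOrderedRing A]
    (ω₁ ω₂ : A →ₚ[ℂ] ℂ) : Prop :=
  DisjointRepresentations ω₁.gnsStarAlgHom ω₂.gnsStarAlgHom

/-! Disjoint states are at norm distance 2, and weak* limits together with density of the local
algebras carry this back to the finite systems, where 2 is also the trivial upper bound. For the
distance, polar decomposition shows that disjoint representations have no nonzero intertwiner
(`DisjointRepresentations.intertwiner_eq_zero`). Projections onto invariant subspaces of the direct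
sum are therefore block diagonal. With Hahn-Banach in a doubled representation this gives a
self-adjoint `a` nearly fixing the first GNS vector and nearly killing the second
(`exists_isSelfAdjoint_norm_sub_lt`). Functional calculus turns `a` into an effect `e`, and `2e - 1`
almost attains the distance. No bicommutant or density theorem is needed. -/

/-! ### Disjointness and intertwining operators -/

section Intertwiner

variable {A E₁ E₂ : Type*} [CStarAlgebra A]
    [NormedAddCommGroup E₁] [InnerProductSpace ℂ E₁] [CompleteSpace E₁]
    [NormedAddCommGroup E₂] [InnerProductSpace ℂ E₂] [CompleteSpace E₂]

/-- The square root of `T† T` has the same norm as `T` on every vector. -/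
theorem ContinuousLinearMap.norm_sqrt_adjoint_comp_self_apply (T : E₁ →L[ℂ] E₂) (x : E₁) :
    ‖CFC.sqrt (T.adjoint ∘L T) x‖ = ‖T x‖ := by
  have hpos : 0 ≤ T.adjoint ∘L T :=
    (ContinuousLinearMap.nonneg_iff_isPositive _).2 T.isPositive_adjoint_comp_self
  set S := CFC.sqrt (T.adjoint ∘L T)
  have hS : S * S = T.adjoint ∘L T := CFC.sqrt_mul_sqrt_self _ hpos
  have hsa : IsSelfAdjoint S := (CFC.sqrt_nonneg _).isSelfAdjoint
  have h : ⟪S x, S x⟫_ℂ = ⟪T x, T x⟫_ℂ := by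
    calc ⟪S x, S x⟫_ℂ = ⟪x, (S * S) x⟫_ℂ := by
          have := ContinuousLinearMap.adjoint_inner_right S x (S x)
          rw [hsa.adjoint_eq] at this
          exact this.symm
      _ = ⟪T x, T x⟫_ℂ := by
          rw [hS, ContinuousLinearMap.comp_apply, ContinuousLinearMap.adjoint_inner_right]
  rw [inner_self_eq_norm_sq_to_K, inner_self_eq_norm_sq_to_K] at h
  have h' : ‖S x‖ ^ 2 = ‖T x‖ ^ 2 := by exact_mod_cast h
  exact (sq_eq_sq₀ (norm_nonneg _) (norm_nonneg _)).1 h'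

/-- The closure of the range of an operator that commutes with a representation. -/
theorem isSubrepresentation_closure_range {F : Type*} [NormedAddCommGroup F]
    [InnerProductSpace ℂ F] (π₂ : A →⋆ₐ[ℂ] (E₂ →L[ℂ] E₂)) (σ : A → F → F)
    (T : F →L[ℂ] E₂) (hT : ∀ a x, T (σ a x) = π₂ a (T x)) :
    IsSubrepresentation π₂ (LinearMap.range T.toLinearMap).topologicalClosure := by
  refine ⟨Submodule.isClosed_topologicalClosure _, fun a v hv => ?_⟩
  refine map_mem_closure (π₂ a).continuous hv ?_
  rintro _ ⟨x, rfl⟩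
  exact ⟨σ a x, hT a x⟩

/-- An operator, viewed as a map into the closure of its range, has dense range. -/
theorem denseRange_codRestrict_closure {E F : Type*}
    [NormedAddCommGroup E] [InnerProductSpace ℂ E] [NormedAddCommGroup F] [InnerProductSpace ℂ F]
    (R : E →L[ℂ] F) (hR : ∀ x, R x ∈ (LinearMap.range R.toLinearMap).topologicalClosure) :
    DenseRange (R.toLinearMap.codRestrict _ hR) := by
  rintro ⟨v, hv⟩
  rw [closure_subtype, ← Set.range_comp]
  exact hv

/-- There are no nonzero intertwining operators between disjoint representations. -/
theorem DisjointRepresentations.intertwiner_eq_zero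
    {π₁ : A →⋆ₐ[ℂ] (E₁ →L[ℂ] E₁)} {π₂ : A →⋆ₐ[ℂ] (E₂ →L[ℂ] E₂)}
    (h : DisjointRepresentations π₁ π₂) (T : E₁ →L[ℂ] E₂)
    (hT : ∀ a, T ∘L π₁ a = π₂ a ∘L T) : T = 0 := by
  set S := CFC.sqrt (T.adjoint ∘L T) with hSdef
  have hnorm : ∀ x, ‖T x‖ = ‖S x‖ := fun x =>
    (T.norm_sqrt_adjoint_comp_self_apply x).symm
  have hT' : ∀ a, T.adjoint ∘L π₂ a = π₁ a ∘L T.adjoint := by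
    intro a
    have := congrArg ContinuousLinearMap.adjoint (hT (star a))
    rw [ContinuousLinearMap.adjoint_comp, ContinuousLinearMap.adjoint_comp,
      ← ContinuousLinearMap.star_eq_adjoint, ← ContinuousLinearMap.star_eq_adjoint (π₂ (star a)),
      ← map_star, ← map_star, star_star] at this
    exact this.symm
  have hcomm : ∀ a, Commute (T.adjoint ∘L T) (π₁ a) := by
    intro a
    change (T.adjoint ∘L T) ∘L π₁ a = π₁ a ∘L (T.adjoint ∘L T)
    rw [ContinuousLinearMap.comp_assoc, hT, ← ContinuousLinearMap.comp_assoc, hT',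
      ContinuousLinearMap.comp_assoc]
  have hS : ∀ a x, S (π₁ a x) = π₁ a (S x) := by
    intro a x
    have : Commute S (π₁ a) := (hcomm a).cfcₙ_nnreal _
    exact congrArg (fun R : E₁ →L[ℂ] E₁ => R x) this.eq
  have hTa : ∀ a x, T (π₁ a x) = π₂ a (T x) := fun a x =>
    congrArg (fun R : E₁ →L[ℂ] E₂ => R x) (hT a)
  by_contra hne
  set K₁ := (LinearMap.range S.toLinearMap).topologicalClosure
  set K₂ := (LinearMap.range T.toLinearMap).topologicalClosure
  have hS_mem : ∀ x, S x ∈ K₁ := fun x => subset_closure ⟨x, rfl⟩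
  have hT_mem : ∀ x, T x ∈ K₂ := fun x => subset_closure ⟨x, rfl⟩
  have : CompleteSpace K₁ := (Submodule.isClosed_topologicalClosure _).completeSpace_coe
  have : CompleteSpace K₂ := (Submodule.isClosed_topologicalClosure _).completeSpace_coe
  let e₁ : E₁ →ₗ[ℂ] K₁ := S.toLinearMap.codRestrict _ hS_mem
  let e₂ : E₁ →ₗ[ℂ] K₂ := T.toLinearMap.codRestrict _ hT_mem
  have hd₁ : DenseRange e₁ := denseRange_codRestrict_closure S hS_mem
  have hd₂ : DenseRange e₂ := denseRange_codRestrict_closure T hT_mem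
  -- The partial isometry of the polar decomposition: `S x ↦ T x`, extended to the closures of the
  -- ranges.
  let U : K₁ ≃ₗᵢ[ℂ] K₂ :=
    (LinearEquiv.refl ℂ E₁).extendOfIsometry e₁ e₂ hd₁ hd₂ hnorm
  have hU : ∀ x, U (e₁ x) = e₂ x := fun x =>
    LinearMap.extendOfNorm_eq hd₁ ⟨1, fun x => by rw [one_mul]; exact (hnorm x).le⟩ x
  have hsub₁ : IsSubrepresentation π₁ K₁ :=
    isSubrepresentation_closure_range π₁ (fun a x => π₁ a x) S hS
  have hsub₂ : IsSubrepresentation π₂ K₂ :=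
    isSubrepresentation_closure_range π₂ (fun a x => π₁ a x) T hTa
  refine h K₁ K₂ hsub₁ hsub₂ ?_ ⟨U, ?_⟩
  · intro hbot
    apply hne
    ext x
    have : S x ∈ (⊥ : Submodule ℂ E₁) := hbot ▸ hS_mem x
    rw [Submodule.mem_bot] at this
    simpa [this] using hnorm x
  · intro a v w hw
    have key : ∀ v : K₁, (U ⟨π₁ a v, hsub₁.2 a v v.2⟩ : E₂) = π₂ a (U v) := by
      intro v
      refine hd₁.induction_on (p := fun v : K₁ =>
        (U ⟨π₁ a v, hsub₁.2 a v v.2⟩ : E₂) = π₂ a (U v)) v ?_ ?_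
      · refine isClosed_eq ?_ ?_
        · exact continuous_subtype_val.comp (U.continuous.comp
            (((π₁ a).continuous.comp continuous_subtype_val).subtype_mk _))
        · exact (π₂ a).continuous.comp (continuous_subtype_val.comp U.continuous)
      · intro x
        have h1 : (⟨π₁ a (e₁ x), hsub₁.2 a (e₁ x) (e₁ x).2⟩ : K₁) = e₁ (π₁ a x) :=
          Subtype.ext (hS a x).symm
        rw [h1, hU, hU]
        exact hTa a x
    have hw' : w = ⟨π₁ a v, hsub₁.2 a v v.2⟩ := Subtype.ext hw
    rw [hw']
    exact key v

end Intertwiner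

/-! ### Hilbert sums of two spaces -/

theorem l2_ext {E₁ E₂ : Type*} {v w : WithLp 2 (E₁ × E₂)} (h₁ : v.fst = w.fst)
    (h₂ : v.snd = w.snd) : v = w :=
  WithLp.ofLp_injective 2 (Prod.ext h₁ h₂)

section Hilbert

variable {E₁ E₂ : Type*} [NormedAddCommGroup E₁] [InnerProductSpace ℂ E₁]
    [NormedAddCommGroup E₂] [InnerProductSpace ℂ E₂]

/-- The inclusion of the first summand into the Hilbert sum. -/
noncomputable def l2inl (E₁ E₂ : Type*) [NormedAddCommGroup E₁]
    [InnerProductSpace ℂ E₁] [NormedAddCommGroup E₂] [InnerProductSpace ℂ E₂] : E₁ →L[ℂ] WithLp 2 (E₁ × E₂) :=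
  (WithLp.prodContinuousLinearEquiv 2 ℂ E₁ E₂).symm.toContinuousLinearMap ∘L
    ContinuousLinearMap.inl ℂ E₁ E₂

/-- The inclusion of the second summand into the Hilbert sum. -/
noncomputable def l2inr (E₁ E₂ : Type*) [NormedAddCommGroup E₁]
    [InnerProductSpace ℂ E₁] [NormedAddCommGroup E₂] [InnerProductSpace ℂ E₂] : E₂ →L[ℂ] WithLp 2 (E₁ × E₂) :=
  (WithLp.prodContinuousLinearEquiv 2 ℂ E₁ E₂).symm.toContinuousLinearMap ∘L
    ContinuousLinearMap.inr ℂ E₁ E₂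

/-- The diagonal operator on the Hilbert sum. -/
noncomputable def l2map (S : E₁ →L[ℂ] E₁) (T : E₂ →L[ℂ] E₂) :
    WithLp 2 (E₁ × E₂) →L[ℂ] WithLp 2 (E₁ × E₂) :=
  (WithLp.prodContinuousLinearEquiv 2 ℂ E₁ E₂).symm.toContinuousLinearMap ∘L
    (S.prodMap T) ∘L (WithLp.prodContinuousLinearEquiv 2 ℂ E₁ E₂).toContinuousLinearMap

theorem l2inl_apply (x : E₁) : l2inl E₁ E₂ x = WithLp.toLp 2 (x, 0) := rfl

theorem l2inr_apply (x : E₂) : l2inr E₁ E₂ x = WithLp.toLp 2 (0, x) := rfl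

theorem l2map_apply (S : E₁ →L[ℂ] E₁) (T : E₂ →L[ℂ] E₂) (v : WithLp 2 (E₁ × E₂)) :
    l2map S T v = WithLp.toLp 2 (S v.fst, T v.snd) := rfl

end Hilbert

/-! ### Direct sums of representations and approximate separation of vectors -/

section DirectSum

variable {A E₁ E₂ : Type*} [CStarAlgebra A]
    [NormedAddCommGroup E₁] [InnerProductSpace ℂ E₁] [CompleteSpace E₁]
    [NormedAddCommGroup E₂] [InnerProductSpace ℂ E₂] [CompleteSpace E₂]

/-- The direct sum of two representations. -/
noncomputable def directSumRep (π₁ : A →⋆ₐ[ℂ] (E₁ →L[ℂ] E₁)) (π₂ : A →⋆ₐ[ℂ] (E₂ →L[ℂ] E₂)) :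
    A →⋆ₐ[ℂ] (WithLp 2 (E₁ × E₂) →L[ℂ] WithLp 2 (E₁ × E₂)) where
  toFun a := l2map (π₁ a) (π₂ a)
  map_one' := by
    refine ContinuousLinearMap.ext fun v => l2_ext ?_ ?_ <;> simp [l2map_apply]
  map_mul' a b := by
    refine ContinuousLinearMap.ext fun v => l2_ext ?_ ?_ <;> simp [l2map_apply]
  map_zero' := by
    refine ContinuousLinearMap.ext fun v => l2_ext ?_ ?_ <;> simp [l2map_apply]
  map_add' a b := by
    refine ContinuousLinearMap.ext fun v => l2_ext ?_ ?_ <;> simp [l2map_apply]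
  commutes' r := by
    refine ContinuousLinearMap.ext fun v => l2_ext ?_ ?_ <;> simp [l2map_apply, Algebra.algebraMap_eq_smul_one]
  map_star' a := by
    rw [ContinuousLinearMap.star_eq_adjoint, ContinuousLinearMap.eq_adjoint_iff]
    intro v w
    simp only [WithLp.prod_inner_apply, l2map_apply, map_star,
      ContinuousLinearMap.star_eq_adjoint, ContinuousLinearMap.adjoint_inner_left]
    rfl

theorem directSumRep_apply (π₁ : A →⋆ₐ[ℂ] (E₁ →L[ℂ] E₁)) (π₂ : A →⋆ₐ[ℂ] (E₂ →L[ℂ] E₂))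
    (a : A) (v : WithLp 2 (E₁ × E₂)) :
    directSumRep π₁ π₂ a v = WithLp.toLp 2 (π₁ a v.fst, π₂ a v.snd) := rfl

/-- The projection onto an invariant closed subspace commutes with the representation. -/
theorem IsSubrepresentation.starProjection_apply {π : A →⋆ₐ[ℂ] (E₁ →L[ℂ] E₁)}
    {K : Submodule ℂ E₁} [K.HasOrthogonalProjection] (hK : IsSubrepresentation π K)
    (a : A) (v : E₁) :
    K.starProjection (π a v) = π a (K.starProjection v) := by
  refine Submodule.eq_starProjection_of_mem_orthogonal
    (hK.2 a _ (K.starProjection_apply_mem v)) ?_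
  rw [← map_sub, Submodule.mem_orthogonal]
  intro u hu
  rw [← ContinuousLinearMap.adjoint_inner_left, ← ContinuousLinearMap.star_eq_adjoint, ← map_star]
  exact (Submodule.mem_orthogonal _ _).1 (K.sub_starProjection_mem_orthogonal v) _
    (hK.2 (star a) u hu)

/-- If there are no intertwining operators between two representations, the closed cyclic subspace
of their sum generated by `(v₁, v₂)` contains `(v₁, 0)`. -/
theorem mem_closure_range_directSumRep (π₁ : A →⋆ₐ[ℂ] (E₁ →L[ℂ] E₁))
    (π₂ : A →⋆ₐ[ℂ] (E₂ →L[ℂ] E₂))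
    (h₁₂ : ∀ T : E₁ →L[ℂ] E₂, (∀ a x, T (π₁ a x) = π₂ a (T x)) → T = 0)
    (h₂₁ : ∀ T : E₂ →L[ℂ] E₁, (∀ a x, T (π₂ a x) = π₁ a (T x)) → T = 0)
    (v₁ : E₁) (v₂ : E₂) :
    WithLp.toLp 2 (v₁, (0 : E₂)) ∈
      closure (Set.range fun a => directSumRep π₁ π₂ a (WithLp.toLp 2 (v₁, v₂))) := by
  set ρ := directSumRep π₁ π₂
  set v : WithLp 2 (E₁ × E₂) := WithLp.toLp 2 (v₁, v₂)
  let R : A →ₗ[ℂ] WithLp 2 (E₁ × E₂) :=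
    { toFun := fun a => ρ a v
      map_add' := fun a b => by simp
      map_smul' := fun c a => by simp }
  set K := (LinearMap.range R).topologicalClosure
  have hKcl : IsClosed (K : Set (WithLp 2 (E₁ × E₂))) := Submodule.isClosed_topologicalClosure _
  have : CompleteSpace K := hKcl.completeSpace_coe
  have hK : IsSubrepresentation ρ K := by
    refine ⟨hKcl, fun a w hw => map_mem_closure (ρ a).continuous hw ?_⟩
    rintro _ ⟨b, rfl⟩
    exact ⟨a * b, by simp [R]⟩
  set P := K.starProjection
  have hP : ∀ a w, P (ρ a w) = ρ a (P w) := fun a w => hK.starProjection_apply a w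
  have hvK : v ∈ K := subset_closure ⟨1, by simp [R]⟩
  have hPv : P v = v := Submodule.starProjection_eq_self_iff.2 hvK
  have hl : ∀ a x, ρ a (l2inl E₁ E₂ x) = l2inl E₁ E₂ (π₁ a x) := fun a x => by
    simp [ρ, directSumRep_apply, l2inl_apply]
  have hr : ∀ a x, ρ a (l2inr E₁ E₂ x) = l2inr E₁ E₂ (π₂ a x) := fun a x => by
    simp [ρ, directSumRep_apply, l2inr_apply]
  -- The off-diagonal blocks of `P` are intertwiners, so they vanish; then `P v = v` splits into
  -- components.
  have hlr : WithLp.sndL 2 ℂ E₁ E₂ ∘L P ∘L l2inl E₁ E₂ = 0 := by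
    refine h₁₂ _ fun a x => ?_
    simp only [ContinuousLinearMap.comp_apply, ← hl, hP]
    rfl
  have hrl : WithLp.fstL 2 ℂ E₁ E₂ ∘L P ∘L l2inr E₁ E₂ = 0 := by
    refine h₂₁ _ fun a x => ?_
    simp only [ContinuousLinearMap.comp_apply, ← hr, hP]
    rfl
  have h1 : (P (l2inl E₁ E₂ v₁)).snd = 0 := congrArg (fun T : E₁ →L[ℂ] E₂ => T v₁) hlr
  have h2 : (P (l2inr E₁ E₂ v₂)).fst = 0 := congrArg (fun T : E₂ →L[ℂ] E₁ => T v₂) hrl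
  have hsum : v = l2inl E₁ E₂ v₁ + l2inr E₁ E₂ v₂ := by
    refine l2_ext ?_ ?_ <;> simp [v, l2inl_apply, l2inr_apply]
  have h3 : (P (l2inl E₁ E₂ v₁)).fst = v₁ := by
    have := congrArg WithLp.fst hPv
    rw [hsum, map_add, WithLp.add_fst, WithLp.add_fst, h2] at this
    simpa [l2inl_apply, l2inr_apply] using this
  have h4 : P (l2inl E₁ E₂ v₁) = WithLp.toLp 2 (v₁, (0 : E₂)) := by
    refine l2_ext ?_ ?_
    · exact h3
    · exact h1
  rw [← h4]
  exact K.starProjection_apply_mem _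

/-- Disjoint representations stay disjoint, in the sense of intertwining operators, when both are
doubled. -/
theorem intertwiner_directSumRep_self_eq_zero {π₁ : A →⋆ₐ[ℂ] (E₁ →L[ℂ] E₁)}
    {π₂ : A →⋆ₐ[ℂ] (E₂ →L[ℂ] E₂)}
    (h : ∀ T : E₁ →L[ℂ] E₂, (∀ a x, T (π₁ a x) = π₂ a (T x)) → T = 0)
    (T : WithLp 2 (E₁ × E₁) →L[ℂ] WithLp 2 (E₂ × E₂))
    (hT : ∀ a x, T (directSumRep π₁ π₁ a x) = directSumRep π₂ π₂ a (T x)) : T = 0 := by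
  have hl : ∀ a x, l2inl E₁ E₁ (π₁ a x) = directSumRep π₁ π₁ a (l2inl E₁ E₁ x) := fun a x => by
    simp [directSumRep_apply, l2inl_apply]
  have hr : ∀ a x, l2inr E₁ E₁ (π₁ a x) = directSumRep π₁ π₁ a (l2inr E₁ E₁ x) := fun a x => by
    simp [directSumRep_apply, l2inr_apply]
  have key : ∀ i : E₁ →L[ℂ] WithLp 2 (E₁ × E₁),
      (∀ a x, i (π₁ a x) = directSumRep π₁ π₁ a (i x)) → ∀ x, T (i x) = 0 := by
    intro i hi x
    have hf : WithLp.fstL 2 ℂ E₂ E₂ ∘L T ∘L i = 0 := h _ fun a x => by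
      simp only [ContinuousLinearMap.comp_apply, hi, hT]
      rfl
    have hs : WithLp.sndL 2 ℂ E₂ E₂ ∘L T ∘L i = 0 := h _ fun a x => by
      simp only [ContinuousLinearMap.comp_apply, hi, hT]
      rfl
    refine l2_ext ?_ ?_
    · exact congrArg (fun T : E₁ →L[ℂ] E₂ => T x) hf
    · exact congrArg (fun T : E₁ →L[ℂ] E₂ => T x) hs
  refine ContinuousLinearMap.ext fun x => ?_
  have hx : x = l2inl E₁ E₁ x.fst + l2inr E₁ E₁ x.snd := by
    refine l2_ext ?_ ?_ <;> simp [l2inl_apply, l2inr_apply]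
  rw [hx, map_add, key _ hl, key _ hr]
  simp

/-- For disjoint representations there are self-adjoint elements acting almost as the identity on a
vector of the first and almost as zero on a vector of the second. -/
theorem exists_isSelfAdjoint_norm_sub_lt (π₁ : A →⋆ₐ[ℂ] (E₁ →L[ℂ] E₁))
    (π₂ : A →⋆ₐ[ℂ] (E₂ →L[ℂ] E₂))
    (h₁₂ : ∀ T : E₁ →L[ℂ] E₂, (∀ a x, T (π₁ a x) = π₂ a (T x)) → T = 0)
    (h₂₁ : ∀ T : E₂ →L[ℂ] E₁, (∀ a x, T (π₂ a x) = π₁ a (T x)) → T = 0)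
    (ξ₁ : E₁) (ξ₂ : E₂) {ε : ℝ} (hε : 0 < ε) :
    ∃ a : A, IsSelfAdjoint a ∧ ‖π₁ a ξ₁ - ξ₁‖ < ε ∧ ‖π₂ a ξ₂‖ < ε := by
  set ρ := directSumRep π₁ π₂
  set ζ : WithLp 2 (E₁ × E₂) := WithLp.toLp 2 (ξ₁, ξ₂) with hζ
  set w : WithLp 2 (E₁ × E₂) := WithLp.toLp 2 (ξ₁, (0 : E₂)) with hw
  set S : Set (WithLp 2 (E₁ × E₂)) := (fun a => ρ a ζ) '' {a | IsSelfAdjoint a}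
  suffices hmem : w ∈ closure S by
    obtain ⟨_, ⟨a, ha, rfl⟩, hd⟩ := Metric.mem_closure_iff.1 hmem ε hε
    rw [dist_comm, dist_eq_norm] at hd
    refine ⟨a, ha, lt_of_le_of_lt ?_ hd, lt_of_le_of_lt ?_ hd⟩
    · exact WithLp.norm_fst_le (p := 2) (x := ρ a ζ - w)
    · simpa [ρ, ζ, w, directSumRep_apply] using WithLp.norm_snd_le (p := 2) (x := ρ a ζ - w)
  by_contra hnot
  have hconv : Convex ℝ S := by
    rintro _ ⟨a, ha, rfl⟩ _ ⟨b, hb, rfl⟩ s t - - -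
    refine ⟨(s : ℂ) • a + (t : ℂ) • b, ?_, ?_⟩
    · simp only [Set.mem_ofPred_eq] at ha hb ⊢
      rw [isSelfAdjoint_iff, star_add, star_smul, star_smul, ha.star_eq, hb.star_eq]
      simp
    · simp only [map_add, map_smul, add_apply, smul_apply]
      rfl
  obtain ⟨f, u, hfS, hfw⟩ :=
    RCLike.geometric_hahn_banach_closed_point (𝕜 := ℂ) hconv.closure isClosed_closure hnot
  have hfS' : ∀ a, IsSelfAdjoint a → (f (ρ a ζ)).re < u := fun a ha =>
    hfS _ (subset_closure ⟨a, ha, rfl⟩)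
  have hu : 0 < u := by simpa using hfS' 0 (IsSelfAdjoint.zero A)
  -- A real-linear functional bounded above on a real subspace vanishes there: otherwise some real
  -- multiple of `a` would attain `u` itself.
  have hf0 : ∀ a, IsSelfAdjoint a → (f (ρ a ζ)).re = 0 := by
    intro a ha
    by_contra hne
    set t : ℝ := u / (f (ρ a ζ)).re
    have := hfS' ((t : ℂ) • a) (by
      rw [isSelfAdjoint_iff, star_smul, ha.star_eq]; simp)
    have h2 : (f (ρ ((t : ℂ) • a) ζ)).re = u := by
      simp only [map_smul, smul_apply, smul_eq_mul, Complex.re_ofReal_mul]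
      exact div_mul_cancel₀ _ hne
    exact this.ne h2
  set η := (InnerProductSpace.toDual ℂ _).symm f with hη
  have hfη : ∀ v, f v = ⟪η, v⟫_ℂ := fun v => InnerProductSpace.toDual_symm_apply.symm
  -- For self-adjoint `a` this sum is twice the vanishing real part. Unlike the real part it is
  -- complex linear in `a`, so it vanishes on all of `A`.
  have hsa : ∀ a, IsSelfAdjoint a → ⟪η, ρ a ζ⟫_ℂ + ⟪ζ, ρ a η⟫_ℂ = 0 := by
    intro a ha
    have h1 : ⟪ζ, ρ a η⟫_ℂ = starRingEnd ℂ ⟪η, ρ a ζ⟫_ℂ := by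
      rw [inner_conj_symm, ← ContinuousLinearMap.adjoint_inner_left,
        ← ContinuousLinearMap.star_eq_adjoint, ← map_star, ha.star_eq]
    rw [h1, Complex.add_conj, ← hfη, hf0 a ha]
    simp
  have hall : ∀ a, ⟪η, ρ a ζ⟫_ℂ + ⟪ζ, ρ a η⟫_ℂ = 0 := by
    intro a
    have h1 := hsa _ (realPart a).2
    have h2 := hsa _ (imaginaryPart a).2
    rw [← realPart_add_I_smul_imaginaryPart a]
    simp only [map_add, map_smul, add_apply, smul_apply,
      inner_add_right, inner_smul_right]
    linear_combination h1 + Complex.I * h2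
  -- The relation `hall` concerns the orbit of the pair `(ζ, η)`. Regrouped by representation, the
  -- pair lives in the sum of the doubled `π₁` and the doubled `π₂`, so its `π₂` half may be
  -- replaced by zero. What remains is that `⟪η.fst, ξ₁⟫` has zero real part, against `hfw`.
  have hcl := mem_closure_range_directSumRep (directSumRep π₁ π₁) (directSumRep π₂ π₂)
    (intertwiner_directSumRep_self_eq_zero h₁₂) (intertwiner_directSumRep_self_eq_zero h₂₁)
    (WithLp.toLp 2 (ξ₁, η.fst)) (WithLp.toLp 2 (ξ₂, η.snd))
  have hG : IsClosed {z : WithLp 2 (WithLp 2 (E₁ × E₁) × WithLp 2 (E₂ × E₂)) |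
      ⟪η.fst, z.fst.fst⟫_ℂ + ⟪η.snd, z.snd.fst⟫_ℂ +
        (⟪ξ₁, z.fst.snd⟫_ℂ + ⟪ξ₂, z.snd.snd⟫_ℂ) = 0} := by
    have c₁ := (WithLp.fstL 2 ℂ (WithLp 2 (E₁ × E₁)) (WithLp 2 (E₂ × E₂))).continuous
    have c₂ := (WithLp.sndL 2 ℂ (WithLp 2 (E₁ × E₁)) (WithLp 2 (E₂ × E₂))).continuous
    have c₁₁ := (WithLp.fstL 2 ℂ E₁ E₁).continuous.comp c₁
    have c₁₂ := (WithLp.sndL 2 ℂ E₁ E₁).continuous.comp c₁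
    have c₂₁ := (WithLp.fstL 2 ℂ E₂ E₂).continuous.comp c₂
    have c₂₂ := (WithLp.sndL 2 ℂ E₂ E₂).continuous.comp c₂
    exact isClosed_eq (((continuous_const.inner c₁₁).add (continuous_const.inner c₂₁)).add
      ((continuous_const.inner c₁₂).add (continuous_const.inner c₂₂))) continuous_const
  have hz := closure_minimal (s := Set.range _) (by
    rintro _ ⟨a, rfl⟩
    have := hall a
    rw [WithLp.prod_inner_apply, WithLp.prod_inner_apply] at this
    exact this) hG hcl
  have hz' : ⟪η.fst, ξ₁⟫_ℂ + ⟪ξ₁, η.fst⟫_ℂ = 0 := by simpa using hz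
  have hfw' : f w = ⟪η.fst, ξ₁⟫_ℂ := by
    rw [hfη, WithLp.prod_inner_apply]
    simp [w]
  rw [hfw'] at hfw
  rw [← inner_conj_symm ξ₁, Complex.add_conj] at hz'
  have : (⟪η.fst, ξ₁⟫_ℂ).re = 0 := by simpa using hz'
  have hlt : u < (⟪η.fst, ξ₁⟫_ℂ).re := hfw
  linarith

end DirectSum

/-! ### Separating disjoint states by effects -/

section Separation

variable {A : Type*} [CStarAlgebra A] [PartialOrder A] [StarOrderedRing A]

theorem PositiveLinearMap.norm_sq_gnsStarAlgHom_apply_one (ω : A →ₚ[ℂ] ℂ) (a : A) :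
    ((‖ω.gnsStarAlgHom a (ω.toPreGNS 1 : ω.GNS)‖ ^ 2 : ℝ) : ℂ) = ω (star a * a) := by
  have h : ω.gnsStarAlgHom a (ω.toPreGNS 1 : ω.GNS) = (ω.toPreGNS a : ω.GNS) := by
    refine (ω.gnsNonUnitalStarAlgHom_apply_coe).trans ?_
    simp
  rw [h, UniformSpace.Completion.norm_coe, Complex.ofReal_pow, PositiveLinearMap.preGNS_norm_sq]
  simp

/-- An effect that is close to the spectral projection of a self-adjoint element separating `0`
from `1`. -/
theorem exists_effect_le {a : A} (ha : IsSelfAdjoint a) :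
    ∃ e : A, 0 ≤ e ∧ e ≤ 1 ∧ e ≤ (2 : ℂ) • (star a * a) ∧
      1 - e ≤ (2 : ℂ) • (star (a - 1) * (a - 1)) := by
  -- A continuous substitute for a spectral projection, with values in `[0, 1]`. Since the
  -- denominator is at least `1 / 2`, `f t ≤ 2 t ^ 2` and `1 - f t ≤ 2 (1 - t) ^ 2`.
  let f : ℝ → ℝ := fun t => t ^ 2 / (t ^ 2 + (1 - t) ^ 2)
  have hden : ∀ t : ℝ, 1 / 2 ≤ t ^ 2 + (1 - t) ^ 2 := fun t => by
    nlinarith [sq_nonneg (2 * t - 1)]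
  have hpos : ∀ t : ℝ, 0 < t ^ 2 + (1 - t) ^ 2 := fun t => by linarith [hden t]
  have hf : Continuous f := by
    refine Continuous.div (by fun_prop) (by fun_prop) fun t => (hpos t).ne'
  have h1f : ∀ t, 1 - f t = (1 - t) ^ 2 / (t ^ 2 + (1 - t) ^ 2) := fun t => by
    have := (hpos t).ne'
    simp only [f]
    field_simp
    ring
  have hbound : ∀ s t : ℝ, s ^ 2 / (t ^ 2 + (1 - t) ^ 2) ≤ 2 * s ^ 2 := fun s t => by
    rw [div_le_iff₀ (hpos t)]
    nlinarith [hden t, sq_nonneg s]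
  have hsq : ∀ b : A, ((2 : ℝ) • b) = (2 : ℂ) • b := fun b => by
    rw [← Complex.coe_smul]; simp
  refine ⟨cfc f a, cfc_nonneg fun t _ => div_nonneg (sq_nonneg t) (hpos t).le,
    cfc_le_one f a fun t _ => ?_, ?_, ?_⟩
  · have : 0 ≤ 1 - f t := by rw [h1f]; exact div_nonneg (sq_nonneg _) (hpos t).le
    linarith
  · have h : cfc (fun t : ℝ => 2 * t ^ 2) a = (2 : ℂ) • (star a * a) := by
      rw [cfc_const_mul 2 (fun t : ℝ => t ^ 2) a, cfc_pow_id (R := ℝ) a 2, ha.star_eq, hsq, sq]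
    rw [← h]
    exact cfc_mono (fun t _ => hbound t t)
  · have h : cfc (fun t : ℝ => 2 * (1 - t) ^ 2) a = (2 : ℂ) • (star (a - 1) * (a - 1)) := by
      rw [cfc_const_mul 2 (fun t : ℝ => (1 - t) ^ 2) a,
        cfc_pow (fun t : ℝ => 1 - t) 2 a, cfc_sub (fun _ : ℝ => 1) (fun t : ℝ => t) a,
        cfc_const_one ℝ a, cfc_id' ℝ a, star_sub, star_one, ha.star_eq, hsq, sq]
      congr 1
      noncomm_ring
    have h' : cfc (fun t : ℝ => 1 - f t) a = 1 - cfc f a := by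
      rw [cfc_sub (fun _ : ℝ => 1) f a, cfc_const_one ℝ a]
    rw [← h, ← h']
    exact cfc_mono (fun t _ => by rw [h1f]; exact hbound (1 - t) t)

/-- Disjoint states are separated, up to an arbitrarily small error, by an effect. -/
theorem DisjointStates.exists_effect {ω₁ ω₂ : A →ₚ[ℂ] ℂ} (h : DisjointStates ω₁ ω₂)
    {ε : ℝ} (hε : 0 < ε) :
    ∃ e : A, 0 ≤ e ∧ e ≤ 1 ∧ (ω₁ (1 - e)).re < ε ∧ (ω₂ e).re < ε := by
  have h₁₂ : ∀ T : ω₁.GNS →L[ℂ] ω₂.GNS,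
      (∀ a x, T (ω₁.gnsStarAlgHom a x) = ω₂.gnsStarAlgHom a (T x)) → T = 0 := fun T hT =>
    DisjointRepresentations.intertwiner_eq_zero h T fun a => ContinuousLinearMap.ext (hT a)
  have h₂₁ : ∀ T : ω₂.GNS →L[ℂ] ω₁.GNS,
      (∀ a x, T (ω₂.gnsStarAlgHom a x) = ω₁.gnsStarAlgHom a (T x)) → T = 0 := by
    intro T hT
    have h0 : T.adjoint = 0 := by
      refine DisjointRepresentations.intertwiner_eq_zero h _ fun a => ?_
      have := congrArg ContinuousLinearMap.adjoint (ContinuousLinearMap.ext (hT (star a)) :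
        T ∘L ω₂.gnsStarAlgHom (star a) = ω₁.gnsStarAlgHom (star a) ∘L T)
      rw [ContinuousLinearMap.adjoint_comp, ContinuousLinearMap.adjoint_comp,
        ← ContinuousLinearMap.star_eq_adjoint,
        ← ContinuousLinearMap.star_eq_adjoint (ω₁.gnsStarAlgHom (star a)),
        ← map_star, ← map_star, star_star] at this
      exact this.symm
    rw [← ContinuousLinearMap.adjoint_adjoint T, h0, map_zero]
  set ξ₁ : ω₁.GNS := (ω₁.toPreGNS 1 : ω₁.GNS)
  set ξ₂ : ω₂.GNS := (ω₂.toPreGNS 1 : ω₂.GNS)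
  obtain ⟨a, ha, ha₁, ha₂⟩ := exists_isSelfAdjoint_norm_sub_lt ω₁.gnsStarAlgHom
    ω₂.gnsStarAlgHom h₁₂ h₂₁ ξ₁ ξ₂ (Real.sqrt_pos.2 (half_pos hε))
  obtain ⟨e, he0, he1, hea, hea'⟩ := exists_effect_le ha
  have bound : ∀ (ω : A →ₚ[ℂ] ℂ) (b c : A), b ≤ (2 : ℂ) • (star c * c) →
      ‖ω.gnsStarAlgHom c (ω.toPreGNS 1 : ω.GNS)‖ < √(ε / 2) → (ω b).re < ε := by
    intro ω b c hbc hc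
    have h1 : ω b ≤ ω ((2 : ℂ) • (star c * c)) := OrderHomClass.mono ω hbc
    rw [map_smul, ← PositiveLinearMap.norm_sq_gnsStarAlgHom_apply_one] at h1
    have h2 := (Complex.le_def.1 h1).1
    have h3 := (Real.lt_sqrt (norm_nonneg _)).1 hc
    have h4 : ((2 : ℂ) • ((‖ω.gnsStarAlgHom c (ω.toPreGNS 1 : ω.GNS)‖ ^ 2 : ℝ) : ℂ)).re =
        2 * ‖ω.gnsStarAlgHom c (ω.toPreGNS 1 : ω.GNS)‖ ^ 2 := by
      rw [smul_eq_mul, ← Complex.ofReal_ofNat, ← Complex.ofReal_mul, Complex.ofReal_re]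
    linarith
  refine ⟨e, he0, he1, bound ω₁ _ _ hea' ?_, bound ω₂ _ _ hea ha₂⟩
  rw [map_sub, map_one]
  exact ha₁

/-- The distance of disjoint states is `2`: it is attained, up to an arbitrarily small error, on the
unit ball. -/
theorem DisjointStates.exists_norm_le_one {ω₁ ω₂ : A →ₚ[ℂ] ℂ} (h : DisjointStates ω₁ ω₂)
    (hω₁ : IsState ω₁) (hω₂ : IsState ω₂) {ε : ℝ} (hε : 0 < ε) :
    ∃ b : A, ‖b‖ ≤ 1 ∧ 2 - ε < ‖ω₁ b - ω₂ b‖ := by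
  -- For `b = 2e - 1` the difference of the states is `2 - 2 ω₁(1 - e) - 2 ω₂(e)`, so errors below
  -- `ε / 4` suffice.
  obtain ⟨e, he0, he1, h1, h2⟩ := h.exists_effect (show 0 < ε / 4 by positivity)
  refine ⟨e - (1 - e), ?_, ?_⟩
  · have hsa : IsSelfAdjoint (e - (1 - e)) :=
      he0.isSelfAdjoint.sub ((IsSelfAdjoint.one A).sub he0.isSelfAdjoint)
    have hee : 0 ≤ e * (1 - e) :=
      ((Commute.one_right e).sub_right (Commute.refl e)).mul_nonneg he0 (sub_nonneg.2 he1)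
    have hsq : star (e - (1 - e)) * (e - (1 - e)) ≤ 1 := by
      rw [hsa.star_eq, ← sub_nonneg]
      have : 1 - (e - (1 - e)) * (e - (1 - e)) = (4 : ℕ) • (e * (1 - e)) := by noncomm_ring
      rw [this]
      exact nsmul_nonneg hee 4
    have hn := (CStarAlgebra.norm_le_one_iff_of_nonneg _ (star_mul_self_nonneg _)).2 hsq
    rw [CStarRing.norm_star_mul_self] at hn
    exact le_of_not_gt fun hlt => by nlinarith
  · refine lt_of_lt_of_le ?_ (Complex.re_le_norm _)
    rw [IsState] at hω₁ hω₂
    rw [map_sub, hω₁] at h1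
    simp only [map_sub, hω₁, hω₂, Complex.sub_re, Complex.one_re] at h1 ⊢
    linarith

end Separation

/-! ### Passage to the finite systems -/

theorem QuasilocalAlgebra.norm_vectorFunctional_le {I : Type*} {A : Type*} [CStarAlgebra A]
    {H : Finset I → Type*} [∀ Λ, NormedAddCommGroup (H Λ)] [∀ Λ, InnerProductSpace ℂ (H Λ)]
    [∀ Λ, CompleteSpace (H Λ)] (Q : QuasilocalAlgebra I A H) (Λ : Finset I) (x : H Λ) :
    ‖Q.vectorFunctional Λ x‖ ≤ ‖x‖ * ‖x‖ :=
  LinearMap.mkContinuous_norm_le _ (by positivity) _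

theorem theorem3p1 {I : Type*} {A : Type*} [CStarAlgebra A] [PartialOrder A] [StarOrderedRing A]
    {H : Finset I → Type*} [∀ Λ, NormedAddCommGroup (H Λ)] [∀ Λ, InnerProductSpace ℂ (H Λ)]
    [∀ Λ, CompleteSpace (H Λ)] (Q : QuasilocalAlgebra I A H)
    (Λ : ℕ → Finset I) (hΛ : Tendsto Λ atTop atTop)
    (x y : ∀ k, H (Λ k)) (hx : ∀ k, ‖x k‖ = 1) (hy : ∀ k, ‖y k‖ = 1)
    (φ ψ : ℕ → A →ₚ[ℂ] ℂ) (hφ : ∀ k, IsState (φ k)) (hψ : ∀ k, IsState (ψ k))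
    (hφx : ∀ k, ∀ a : Q.loc (Λ k), φ k a = Q.vectorFunctional (Λ k) (x k) a)
    (hψy : ∀ k, ∀ a : Q.loc (Λ k), ψ k a = Q.vectorFunctional (Λ k) (y k) a)
    (ω₁ ω₂ : A →ₚ[ℂ] ℂ) (hω₁ : IsState ω₁) (hω₂ : IsState ω₂)
    (hφω : WeakStarTendsto φ ω₁) (hψω : WeakStarTendsto ψ ω₂)
    (hdisj : DisjointStates ω₁ ω₂) :
    Q.HasTransitionProbability Λ x y 0 := by
  set N : ℕ → ℝ := fun k =>
    ‖Q.vectorFunctional (Λ k) (x k) - Q.vectorFunctional (Λ k) (y k)‖ with hN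
  have hupper : ∀ k, N k ≤ 2 := fun k => by
    have h1 := Q.norm_vectorFunctional_le (Λ k) (x k)
    have h2 := Q.norm_vectorFunctional_le (Λ k) (y k)
    have h3 := norm_sub_le (Q.vectorFunctional (Λ k) (x k)) (Q.vectorFunctional (Λ k) (y k))
    rw [hx] at h1
    rw [hy] at h2
    simp only [hN]
    linarith
  have hlower : ∀ δ : ℝ, 0 < δ → δ ≤ 2 → ∀ᶠ k in atTop, 2 - δ < N k := by
    intro δ hδ hδ'
    obtain ⟨b, hb, hωb⟩ := hdisj.exists_norm_le_one hω₁ hω₂ (half_pos hδ)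
    -- The bound is scaled by `‖c‖` so that a local approximant `c` of `b` need not lie in the unit
    -- ball.
    have hopen : IsOpen {c : A | (2 - δ) * ‖c‖ < ‖ω₁ c - ω₂ c‖} := by
      have c₁ : Continuous ω₁ := map_continuous ω₁
      have c₂ : Continuous ω₂ := map_continuous ω₂
      exact isOpen_lt (by fun_prop) (by fun_prop)
    have hbmem : b ∈ {c : A | (2 - δ) * ‖c‖ < ‖ω₁ c - ω₂ c‖} := by
      rw [Set.mem_ofPred_eq]
      nlinarith [norm_nonneg b]
    obtain ⟨c, hcb, hc⟩ := Q.dense_iUnion_loc.inter_open_nonempty _ hopen ⟨b, hbmem⟩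
    obtain ⟨Λ₀, hcΛ₀⟩ := Set.mem_iUnion.1 hc
    have hlim : Tendsto (fun k => ‖φ k c - ψ k c‖) atTop (𝓝 ‖ω₁ c - ω₂ c‖) :=
      ((hφω c).sub (hψω c)).norm
    filter_upwards [hlim.eventually_const_lt hcb, hΛ.eventually_ge_atTop Λ₀] with k hk hkΛ
    let c' : Q.loc (Λ k) := ⟨c, Q.isotony _ _ hkΛ hcΛ₀⟩
    -- Once `Λ k` contains `Λ₀`, `c` is an observable of the finite system, so the choice of
    -- extensions `φ k`, `ψ k` is irrelevant.
    have h1 : ‖φ k c - ψ k c‖ ≤ N k * ‖c‖ := by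
      have := (Q.vectorFunctional (Λ k) (x k) - Q.vectorFunctional (Λ k) (y k)).le_opNorm c'
      rw [sub_apply, ← hφx, ← hψy] at this
      exact this
    exact lt_of_mul_lt_mul_right (hk.trans_le h1) (norm_nonneg c)
  have hlim : Tendsto N atTop (𝓝 2) := by
    refine tendsto_order.2 ⟨fun r hr => ?_, fun r hr => ?_⟩
    -- The minimum with 2 covers negative `r`: `hlower` requires `δ ≤ 2`.
    · filter_upwards [hlower (min (2 - r) 2) (lt_min (by linarith) two_pos) (min_le_right _ _)]
        with k hk
      linarith [min_le_left (2 - r) 2]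
    · exact Eventually.of_forall fun k => (hupper k).trans_lt hr
  have := ((hlim.pow 2).const_mul (1 / 4 : ℝ)).const_sub 1
  norm_num at this
  simpa [QuasilocalAlgebra.HasTransitionProbability] using this
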